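/- **Setting.** For every security parameter $\lambda\in\mathbb N$ let $\mathcal X_\lambda,\mathcal R_\lambda,\mathcal Y_\lambda$ be finite sets, where $\mathcal R_\lambda$ and $\mathcal Y_\lambda$ are abelian groups written additively (for instance bit strings under $\oplus$), and let $\mathcal F_\lambda$ be a probability distribution on functions $f:\mathcal X_\lambda\times\mathcal R_\lambda\to\mathcal Y_\lambda$ (for instance the uniform distribution on a finite set of functions). A function of $\lambda$ is *negligible* if it tends to $0$ faster than every inverse polynomial. We drop the index $\lambda$. **Single-effective-query (SEQ) oracle of $f$.** The oracle holds a database register with basis states $|D\rangle$, where $D$ runs over the partial functions $\mathcal X\rightharpoonup\mathcal R$; initially it is in the state $|\emptyset\rangle$. Let $\mathsf{Decomp}_x$ be the operator on the cell of the database at $x$ that exchanges $|\bot\rangle$ with $|\mathcal R|^{-1/2}\sum_{r}|r\rangle$ and fixes every superposition of the $|r\rangle$ that is orthogonal to the latter, and let $\mathsf{Decomp}$ apply $\mathsf{Decomp}_x$ controlled on the query input $|x\rangle$. A query of $|x\rangle|s\rangle$ to the compressed random oracle $H:\mathcal X\to\mathcal R$ is $\mathsf{Decomp}\circ\mathsf{CO}'\circ\mathsf{Decomp}$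 with $\mathsf{CO}'|x\rangle|s\rangle|D\rangle=|x\rangle|s+D(x)\rangle|D\rangle$ (where $s+\bot:=s$). A query to the SEQ oracle acts linearly on the basis states $|x,u,b\rangle\otimes|D\rangle$ with $x\in\mathcal X$, $u\in\mathcal Y$, $b\in\{0,1\}$: if $D$ has an entry at some $x'\ne x$, it does nothing; otherwise it prepares a scratch register in the state $|0\rangle$, queries $|x\rangle|0\rangle$ to the compressed oracle $H$, applies $|x,u,b\rangle|r\rangle\mapsto|x,u+f(x,r),b\oplus1\rangle|r\rangle$, uncomputes the scratch register by the inverse query to $H$, and discards it. **Unlearnability.** In the learning game $f$ is sampled from $\mathcal F_\lambda$, and a quantum adversary with access to the SEQ oracle of $f$ (and no other information on $f$) outputs two triples $(x_1,r_1,y_1),(x_2,r_2,y_2)\in\mathcal X\times\mathcal R\times\mathcal Y$. It wins if $(x_1,r_1)\neq(x_2,r_2)$, $f(x_1,r_1)=y_1$ and $f(x_2,r_2)=y_2$. The family $\mathcal F=\{\mathcal F_\lambda\}_\lambda$ is *SEQ-$\mathsf{negl}(\lambda)$-unlearnable* if the winning probability of every (non-uniform) adversary that makes at most polynomially many oracle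 queries is negligible in $\lambda$. The adversary may use a work register of any finite dimension, an arbitrary initial state, arbitrary unitaries between its queries and an arbitrary final measurement; no bound is put on its running time, so that in particular all non-uniform quantum polynomial-time adversaries are covered. **Proposition.** Suppose that 1. (*pairwise independence*) for all $\lambda$ and all $(x,r,y),(x',r',y')\in\mathcal X\times\mathcal R\times\mathcal Y$ with $(x,r)\ne(x',r')$, $$\Pr_{f\leftarrow\mathcal F_\lambda}[f(x,r)=y\wedge f(x',r')=y']=\Pr_{f\leftarrow\mathcal F_\lambda}[f(x,r)=y]\cdot\Pr_{f\leftarrow\mathcal F_\lambda}[f(x',r')=y'];$$ 2. (*high randomness*) there is a negligible function $\nu$ such that $\Pr_{f\leftarrow\mathcal F_\lambda}[f(x,r)=y]\le\nu(\lambda)$ for all $\lambda$ and all $(x,r,y)\in\mathcal X\times\mathcal R\times\mathcal Y$; 3. $1/|\mathcal R_\lambda|$ is negligible in $\lambda$. Then $\mathcal F$ is SEQ-$\mathsf{negl}(\lambda)$-unlearnable. -/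

import Mathlib

namespace SEQ

open Filter

noncomputable section

universe u v w

/-! ### Negligible functions and probabilities over a function family -/

/-- A function of the security parameter is negligible if it decays faster than the inverse of
every polynomial. -/
abbrev Negligible (μ : ℕ → ℝ) : Prop :=
  Asymptotics.SuperpolynomialDecay atTop (fun n : ℕ => (n : ℝ)) μ

/-- The probability that `f` drawn from the distribution `F` satisfies `E`. -/
def prob {α : Type*} [Fintype α] (F : PMF α) (E : α → Prop) : ℝ :=
  open scoped Classical in ∑ f, if E f then (F f).toReal else 0

/-! ### The compressed single-effective-query oracle -/

/-- A database: a partial function from `X` to `R`, i.e. a set of pairs `(x, r)` with pairwise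
distinct first entries; `D x = none` means that no pair with first entry `x` is recorded. -/
abbrev Database (X : Type u) (R : Type v) := X → Option R

/-- Basis states `|x, u, b⟩` of the query register. -/
abbrev Query (X : Type u) (Y : Type w) := X × Y × Bool

/-- Basis states of the query register, a scratch register holding an element of `R` and the
database register, in this order. -/
abbrev Extended (X : Type u) (R : Type v) (Y : Type w) := Query X Y × R × Database X R

section Oracle

variable {X : Type u} {R : Type v} {Y : Type w}

/-- The linear operator that sends the basis state `|i⟩` to `|e i⟩`, on amplitude functions. -/
def basisMap {ι : Type*} (e : ι ≃ ι) (ψ : ι → ℂ) : ι → ℂ := fun i => ψ (e.symm i)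

/-- Matrix entries `⟨o'| Decomp |o⟩` of the (de)compression operator on one cell of the database.
It exchanges `|⊥⟩` with the uniform superposition `|R|^(-1/2) ∑ r, |r⟩` and fixes every
superposition of the `|r⟩` that is orthogonal to the uniform one. -/
def decompCell [Fintype R] [DecidableEq R] : Option R → Option R → ℂ
  | none, none => 0
  | none, some _ => ((1 / √(Fintype.card R : ℝ) : ℝ) : ℂ)
  | some _, none => ((1 / √(Fintype.card R : ℝ) : ℝ) : ℂ)
  | some r', some r => (if r' = r then 1 else 0) - 1 / (Fintype.card R : ℂ)

/-- `Decomp`: controlled on the query input `x`, apply the (de)compression operator to the cell of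
the database at `x`. -/
def decomp [Fintype R] [DecidableEq R] [DecidableEq X] (ψ : Extended X R Y → ℂ) :
    Extended X R Y → ℂ :=
  fun ((x, u, b), s, D) =>
    ∑ o : Option R, decompCell (D x) o * ψ ((x, u, b), s, Function.update D x o)

/-- `|x⟩ |s⟩ |D⟩ ↦ |x⟩ |s + D(x)⟩ |D⟩`, with the convention `s + ⊥ = s`. -/
def readDatabase [AddCommGroup R] : Extended X R Y ≃ Extended X R Y where
  toFun := fun ((x, u, b), s, D) => ((x, u, b), s + (D x).getD 0, D)
  invFun := fun ((x, u, b), s, D) => ((x, u, b), s - (D x).getD 0, D)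
  left_inv := by rintro ⟨⟨x, u, b⟩, s, D⟩; simp
  right_inv := by rintro ⟨⟨x, u, b⟩, s, D⟩; simp

/-- A query of the scratch register to the compressed random oracle `H : X → R`. -/
def compressedQuery [AddCommGroup R] [Fintype R] [DecidableEq R] [DecidableEq X]
    (ψ : Extended X R Y → ℂ) : Extended X R Y → ℂ :=
  decomp (basisMap readDatabase (decomp ψ))

/-- The inverse of `compressedQuery` (equal to it if `R` consists of bit strings). -/
def compressedUnquery [AddCommGroup R] [Fintype R] [DecidableEq R] [DecidableEq X]
    (ψ : Extended X R Y → ℂ) : Extended X R Y → ℂ :=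
  decomp (basisMap readDatabase.symm (decomp ψ))

/-- `|x, u, b⟩ |r⟩ |D⟩ ↦ |x, u + f(x, r), b ⊕ 1⟩ |r⟩ |D⟩`. -/
def evalFunction [AddCommGroup Y] (f : X × R → Y) : Extended X R Y ≃ Extended X R Y where
  toFun := fun ((x, u, b), r, D) => ((x, u + f (x, r), !b), r, D)
  invFun := fun ((x, u, b), r, D) => ((x, u - f (x, r), !b), r, D)
  left_inv := by rintro ⟨⟨x, u, b⟩, s, D⟩; simp
  right_inv := by rintro ⟨⟨x, u, b⟩, s, D⟩; simp

/-- Answering a query: prepare `|0⟩` in the scratch register, query it to the compressed oracle,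
evaluate `f`, uncompute the scratch register and discard it (it is back in the state `|0⟩`). -/
def answer [AddCommGroup R] [Fintype R] [DecidableEq R] [DecidableEq X] [AddCommGroup Y]
    (f : X × R → Y) (φ : Query X Y × Database X R → ℂ) : Query X Y × Database X R → ℂ :=
  fun (q, D) =>
    compressedUnquery
      (basisMap (evalFunction f)
        (compressedQuery fun (q, s, D) => if s = 0 then φ (q, D) else 0))
      (q, 0, D)

/-- The database has no entry at an input other than the query input. -/
def Answerable (p : Query X Y × Database X R) : Prop := ∀ x' : X, x' ≠ p.1.1 → p.2 x' = none

/-- The single-effective-query oracle of `f` on the query and database registers: the linear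
operator that answers on basis states whose database has no entry at an input other than the
query input, and is the identity on the other basis states. -/
def seqOracle [AddCommGroup R] [Fintype R] [DecidableEq R] [DecidableEq X] [AddCommGroup Y]
    (f : X × R → Y) (φ : Query X Y × Database X R → ℂ) : Query X Y × Database X R → ℂ :=
  open scoped Classical in
  fun p =>
    answer f (fun p' => if Answerable p' then φ p' else 0) p + if Answerable p then 0 else φ p

end Oracle

/-! ### The learning game -/

section Game

variable {X : Type u} {R : Type v} {Y : Type w}

/-- A quantum oracle adversary: it holds a work register of some finite dimension and a query
register, starts in an arbitrary pure state, makes `numQueries` oracle queries, applies the unitary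
`step i` after the query number `i` (counted from `0`), and finally measures its registers in the
computational basis and reads two triples `(x₁, r₁, y₁)`, `(x₂, r₂, y₂)` off the outcome. There is
no bound on the complexity of the state, of the unitaries or of the output map. -/
structure Adversary (X : Type u) (R : Type v) (Y : Type w)
    [Fintype X] [Fintype Y] [DecidableEq X] [DecidableEq Y] where
  workDim : ℕ
  numQueries : ℕ
  init : Fin workDim × Query X Y → ℂ
  init_norm : ∑ i, ‖init i‖ ^ 2 = 1
  step : ℕ → Matrix.unitaryGroup (Fin workDim × Query X Y) ℂ
  output : Fin workDim × Query X Y → (X × R × Y) × (X × R × Y)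

variable [Fintype X] [Fintype Y] [DecidableEq X] [DecidableEq Y]

/-- The joint state of adversary and oracle after `t` queries to the single-effective-query oracle
of `f`, each followed by the adversary's unitary. The database is initially empty. -/
def Adversary.state [AddCommGroup R] [Fintype R] [DecidableEq R] [AddCommGroup Y]
    (A : Adversary X R Y) (f : X × R → Y) :
    ℕ → (Fin A.workDim × Query X Y) × Database X R → ℂ
  | 0 => fun (i, D) => if D = fun _ => none then A.init i else 0
  | t + 1 => fun (i, D) =>
      ∑ j : Fin A.workDim × Query X Y, (A.step t).1 i j *
        seqOracle f (fun (q, D') => A.state f t ((j.1, q), D')) (j.2, D)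

/-- The challenger accepts two triples if their `(x, r)` differ and both are evaluations of `f`. -/
def Wins (f : X × R → Y) (o : (X × R × Y) × (X × R × Y)) : Prop :=
  (o.1.1, o.1.2.1) ≠ (o.2.1, o.2.2.1) ∧
    f (o.1.1, o.1.2.1) = o.1.2.2 ∧ f (o.2.1, o.2.2.1) = o.2.2.2

/-- The probability that `A` wins the learning game for a fixed `f`. -/
def Adversary.winProbFor [AddCommGroup R] [Fintype R] [DecidableEq R] [AddCommGroup Y]
    (A : Adversary X R Y) (f : X × R → Y) : ℝ :=
  open scoped Classical in
  ∑ p : (Fin A.workDim × Query X Y) × Database X R,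
    if Wins f (A.output p.1) then ‖A.state f A.numQueries p‖ ^ 2 else 0

/-- The probability that `A` wins the learning game, over `f` drawn from `F`. -/
def Adversary.winProb [AddCommGroup R] [Fintype R] [DecidableEq R] [AddCommGroup Y]
    (A : Adversary X R Y) (F : PMF (X × R → Y)) : ℝ :=
  ∑ f, (F f).toReal * A.winProbFor f

end Game

/-- Single-effective-query `negl`-unlearnability of a family of distributions over functions,
against all adversaries (a different one for every security parameter) that make polynomially many
oracle queries; every non-uniform quantum polynomial-time adversary is of this kind. -/
def NeglUnlearnable {X : ℕ → Type u} {R : ℕ → Type v} {Y : ℕ → Type w}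
    [∀ n, Fintype (X n)] [∀ n, DecidableEq (X n)]
    [∀ n, Fintype (R n)] [∀ n, DecidableEq (R n)] [∀ n, AddCommGroup (R n)]
    [∀ n, Fintype (Y n)] [∀ n, DecidableEq (Y n)] [∀ n, AddCommGroup (Y n)]
    (F : ∀ n, PMF (X n × R n → Y n)) : Prop :=
  ∀ A : ∀ n, Adversary (X n) (R n) (Y n),
    (∃ p : Polynomial ℕ, ∀ n, (A n).numQueries ≤ p.eval n) →
      Negligible fun n => (A n).winProb (F n)

end

end SEQ

namespace SEQ

open Filter

noncomputable section

universe u v w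

/-! ### Weighted means -/

section Mean

variable {K : Type*} [Fintype K]

/-! The database never holds more than one entry, so for fixed `f` the joint state consists of
amplitudes for the empty database and for each recorded pair `(x, r)`
(`Adversary.represents_state`). A query involves `f` in two ways: pointwise, through the shift by `f
(x, r)` on the branch recording `r`, and globally, through the averages over `r` taken by
decompression and compression.

The idealized run `Adversary.pairRun` does not depend on `f`: its entries are labelled by `(r, y)`
with weight `Pr[f(x, r) = y] / |R|`, the shift is by `y`, and the averages over `r` are replaced by
their expectations. Setting `y = f (x, r)` (`specialize`) gives an approximation of the real run.
Since the idealized amplitudes are fixed before `f` is drawn, pairwise independence makes the terms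
of each average uncorrelated, so its variance is of order `1 / |R|` (`sum_norm_sq_deviation_le`). A
query thus costs an expected squared error of at most `14 / |R|`
(`sum_normSq_functionQuery_sub_le`), and `t` queries cost `14 t (t + 1) / |R|`
(`Adversary.sum_normSq_functionRun_sub_le`).

In the specialized state every branch depends on at most one value `f (x, r)`. Of two distinct input
pairs output by the adversary, one differs from `(x, r)`; its value is independent of the branch and
is guessed with probability at most `ν` (`sum_wins_mul_mass_le`). Altogether the winning probability
is at most `2 ν + 28 q (q + 1) / |R|` for `q` queries. -/

theorem sum_weighted_norm_sq_eq (w : K → ℝ) (hw : ∑ k, w k = 1) (g : K → ℂ) :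
    ∑ k, w k * ‖g k‖ ^ 2 =
      ‖∑ k, (w k : ℂ) * g k‖ ^ 2 + ∑ k, w k * ‖g k - ∑ l, (w l : ℂ) * g l‖ ^ 2 := by
  set m := ∑ l, (w l : ℂ) * g l with hm
  have hre : ∑ k, w k * (g k).re = m.re := by simp [hm]
  have him : ∑ k, w k * (g k).im = m.im := by simp [hm]
  have expand : ∀ k, w k * ‖g k - m‖ ^ 2 = w k * ‖g k‖ ^ 2
      - 2 * m.re * (w k * (g k).re) - 2 * m.im * (w k * (g k).im) + ‖m‖ ^ 2 * w k := by
    intro k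
    simp only [Complex.sq_norm, Complex.normSq_apply, Complex.sub_re, Complex.sub_im]
    ring
  rw [Finset.sum_congr rfl fun k _ => expand k, Finset.sum_add_distrib, Finset.sum_sub_distrib,
    Finset.sum_sub_distrib, ← Finset.mul_sum, ← Finset.mul_sum, ← Finset.mul_sum, hre, him, hw]
  simp only [Complex.sq_norm, Complex.normSq_apply]
  ring

theorem sum_weighted_sub_mean (w : K → ℝ) (hw : ∑ k, w k = 1) (g : K → ℂ) :
    ∑ k, (w k : ℂ) * (g k - ∑ l, (w l : ℂ) * g l) = 0 := by
  have hw' : ∑ k, (w k : ℂ) = 1 := by exact_mod_cast hw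
  simp only [mul_sub, Finset.sum_sub_distrib, ← Finset.sum_mul, hw', one_mul, sub_self]

/-- Decompression does not increase the norm: the shifted family has mean `a` and the variance of
`g`, and only the squared mean of `g` is lost. -/
theorem sum_weighted_norm_sq_add_sub_mean_le (w : K → ℝ) (hw : ∑ k, w k = 1) (a : ℂ)
    (g : K → ℂ) :
    ∑ k, w k * ‖a + g k - ∑ l, (w l : ℂ) * g l‖ ^ 2 ≤ ‖a‖ ^ 2 + ∑ k, w k * ‖g k‖ ^ 2 := by
  have hw' : ∑ k, (w k : ℂ) = 1 := by exact_mod_cast hw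
  have hmean : ∑ k, (w k : ℂ) * (a + g k - ∑ l, (w l : ℂ) * g l) = a := by
    have := sum_weighted_sub_mean w hw g
    calc _ = ∑ k, ((w k : ℂ) * a + (w k : ℂ) * (g k - ∑ l, (w l : ℂ) * g l)) :=
          Finset.sum_congr rfl fun k _ => by ring
      _ = a := by rw [Finset.sum_add_distrib, this, ← Finset.sum_mul, hw']; ring
  rw [sum_weighted_norm_sq_eq w hw fun k => a + g k - ∑ l, (w l : ℂ) * g l, hmean,
    sum_weighted_norm_sq_eq w hw g]
  have : ∀ k, a + g k - ∑ l, (w l : ℂ) * g l - a = g k - ∑ l, (w l : ℂ) * g l :=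
    fun k => by ring
  simp only [this]
  linarith [sq_nonneg ‖∑ l, (w l : ℂ) * g l‖]

theorem norm_sq_sum_weighted_le (w : K → ℝ) (hw0 : ∀ k, 0 ≤ w k) (hw : ∑ k, w k = 1)
    (g : K → ℂ) : ‖∑ k, (w k : ℂ) * g k‖ ^ 2 ≤ ∑ k, w k * ‖g k‖ ^ 2 := by
  rw [sum_weighted_norm_sq_eq w hw g]
  exact le_add_of_nonneg_right
    (Finset.sum_nonneg fun k _ => mul_nonneg (hw0 k) (sq_nonneg _))

theorem norm_add_sq_le_two_mul (a b : ℂ) : ‖a + b‖ ^ 2 ≤ 2 * ‖a‖ ^ 2 + 2 * ‖b‖ ^ 2 := by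
  nlinarith [pow_le_pow_left₀ (norm_nonneg _) (norm_add_le a b) 2, sq_nonneg (‖a‖ - ‖b‖)]

/-- The free parameter `s` lets the errors of successive queries add up to quadratic rather than
exponential growth. -/
theorem norm_add_sq_le_of_pos {s : ℝ} (hs : 0 < s) (a b : ℂ) :
    ‖a + b‖ ^ 2 ≤ (1 + 1 / s) * ‖a‖ ^ 2 + (1 + s) * ‖b‖ ^ 2 := by
  have h1 := pow_le_pow_left₀ (norm_nonneg _) (norm_add_le a b) 2
  have h2 : 0 ≤ 1 / s * (‖a‖ - s * ‖b‖) ^ 2 := by positivity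
  have h3 : 1 / s * (‖a‖ - s * ‖b‖) ^ 2 =
      1 / s * ‖a‖ ^ 2 - 2 * ‖a‖ * ‖b‖ + s * ‖b‖ ^ 2 := by
    field_simp
    ring
  linarith

end Mean

/-! ### Amplitudes relative to at most one database entry -/

/-- Amplitudes of the registers `I` of the adversary with an empty database (first component) and
with a database whose only entry is at `x`, with content labelled by `k` (second component). The
latter are relative to a square-root weight of the label. -/
abbrev Amplitudes (X K I : Type*) := (I → ℂ) × (X → K → I → ℂ)

/-- Basis states of the registers of an adversary with work register of dimension `d`. -/
abbrev Registers (d : ℕ) (X : Type u) (Y : Type w) := Fin d × Query X Y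

section Amplitudes

variable {X : Type u} {K : Type v} {Y : Type w} {d : ℕ}

/-- Undoing the addition of `o x` to the output part of the query register. -/
def unshift [AddCommGroup Y] (o : X → Y) : Registers d X Y ≃ Registers d X Y where
  toFun := fun (z, x, u, b) => (z, x, u - o x, !b)
  invFun := fun (z, x, u, b) => (z, x, u + o x, !b)
  left_inv := by rintro ⟨z, x, u, b⟩; simp
  right_inv := by rintro ⟨z, x, u, b⟩; simp

@[simp] theorem unshift_input [AddCommGroup Y] (o : X → Y) (i : Registers d X Y) :
    (unshift o i).2.1 = i.2.1 := rfl

variable [Fintype K]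

/-- The probability of measuring `i` in the registers of the adversary. -/
def mass {I : Type*} [Fintype X] (w : X → K → ℝ) (ψ : Amplitudes X K I) (i : I) : ℝ :=
  ‖ψ.1 i‖ ^ 2 + ∑ x, ∑ k, w x k * ‖ψ.2 x k i‖ ^ 2

/-- The squared norm of a family of amplitudes with respect to weights. -/
def normSq {I : Type*} [Fintype X] [Fintype I] (w : X → K → ℝ) (ψ : Amplitudes X K I) : ℝ :=
  ∑ i, mass w ψ i

/-- Amplitudes of the contents of the cell at the query input after decompression. -/
def decompressed (w : X → K → ℝ) (ψ : Amplitudes X K (Registers d X Y)) (k : K)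
    (i : Registers d X Y) : ℂ :=
  ψ.1 i + ψ.2 i.2.1 k i - ∑ l, (w i.2.1 l : ℂ) * ψ.2 i.2.1 l i

variable [AddCommGroup Y]

/-- Amplitudes after decompression and evaluation. -/
def evaluated (w : X → K → ℝ) (out : X → K → Y) (ψ : Amplitudes X K (Registers d X Y)) (k : K)
    (i : Registers d X Y) : ℂ :=
  decompressed w ψ k (unshift (fun x => out x k) i)

variable [DecidableEq X]

/-- A query to the single-effective-query oracle on amplitudes. -/
def query (w : X → K → ℝ) (out : X → K → Y) (ψ : Amplitudes X K (Registers d X Y)) :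
    Amplitudes X K (Registers d X Y) :=
  (fun i => ∑ l, (w i.2.1 l : ℂ) * evaluated w out ψ l i,
    fun x k i => if x = i.2.1
      then evaluated w out ψ k i - ∑ l, (w i.2.1 l : ℂ) * evaluated w out ψ l i
      else ψ.2 x k i)

theorem query_sub (w : X → K → ℝ) (out : X → K → Y)
    (ψ φ : Amplitudes X K (Registers d X Y)) :
    query w out (ψ - φ) = query w out ψ - query w out φ := by
  have h : ∀ k i, evaluated w out (ψ - φ) k i = evaluated w out ψ k i - evaluated w out φ k i := by
    intro k i
    simp only [evaluated, decompressed, Prod.fst_sub, Prod.snd_sub, Pi.sub_apply, mul_sub,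
      Finset.sum_sub_distrib]
    ring
  ext
  · simp only [query, h, mul_sub, Finset.sum_sub_distrib, Prod.fst_sub, Pi.sub_apply]
  · simp only [query, h, mul_sub, Finset.sum_sub_distrib, Prod.snd_sub, Pi.sub_apply]
    split_ifs <;> ring

/-- Mean zero says that a recorded cell content is orthogonal to the uniform superposition. This
invariant of compressed states is what leaves no `⊥` part after decompression, as `decompressed`
presupposes. -/
theorem query_mean_eq_zero {w : X → K → ℝ} (hw : ∀ x, ∑ k, w x k = 1) (out : X → K → Y)
    {ψ : Amplitudes X K (Registers d X Y)} (hψ : ∀ x i, ∑ k, (w x k : ℂ) * ψ.2 x k i = 0)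
    (x : X) (i : Registers d X Y) : ∑ k, (w x k : ℂ) * (query w out ψ).2 x k i = 0 := by
  by_cases h : x = i.2.1
  · subst h
    simpa only [query, if_true] using sum_weighted_sub_mean (w i.2.1) (hw _) _
  · simpa only [query, if_neg h] using hψ x i

variable [Fintype X] [Fintype Y]

omit [DecidableEq X] in
-- For a fixed label, evaluation permutes the registers and keeps the query input, so it drops out
-- of the sum and only decompression remains.
theorem sum_evaluated_le {w : X → K → ℝ} (hw : ∀ x, ∑ k, w x k = 1) (out : X → K → Y)
    (ψ : Amplitudes X K (Registers d X Y)) :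
    ∑ i, ∑ k, w i.2.1 k * ‖evaluated w out ψ k i‖ ^ 2 ≤
      ∑ i, (‖ψ.1 i‖ ^ 2 + ∑ k, w i.2.1 k * ‖ψ.2 i.2.1 k i‖ ^ 2) := by
  have : ∑ i, ∑ k, w i.2.1 k * ‖evaluated w out ψ k i‖ ^ 2 =
      ∑ i, ∑ k, w i.2.1 k * ‖decompressed w ψ k i‖ ^ 2 := by
    rw [Finset.sum_comm, Finset.sum_comm (s := Finset.univ (α := Registers d X Y))]
    refine Finset.sum_congr rfl fun k _ => ?_
    exact (unshift fun x => out x k).sum_comp fun i => w i.2.1 k * ‖decompressed w ψ k i‖ ^ 2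
  rw [this]
  exact Finset.sum_le_sum fun i _ => sum_weighted_norm_sq_add_sub_mean_le _ (hw _) _ _

/-- Entries away from the query input are untouched. At the query input, compression splits a family
into its mean and its deviation from the mean, which preserves the second moment exactly. -/
theorem normSq_query_le {w : X → K → ℝ} (hw : ∀ x, ∑ k, w x k = 1) (out : X → K → Y)
    (ψ : Amplitudes X K (Registers d X Y)) : normSq w (query w out ψ) ≤ normSq w ψ := by
  have h1 : ∀ i : Registers d X Y, ‖(query w out ψ).1 i‖ ^ 2 +
        ∑ x, ∑ k, w x k * ‖(query w out ψ).2 x k i‖ ^ 2 =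
      ∑ k, w i.2.1 k * ‖evaluated w out ψ k i‖ ^ 2 +
        ∑ x ∈ Finset.univ.erase i.2.1, ∑ k, w x k * ‖ψ.2 x k i‖ ^ 2 := by
    intro i
    rw [← Finset.add_sum_erase _ _ (Finset.mem_univ i.2.1), ← add_assoc]
    congr 1
    · simp only [query, if_true]
      exact (sum_weighted_norm_sq_eq (w i.2.1) (hw _) fun k => evaluated w out ψ k i).symm
    · refine Finset.sum_congr rfl fun x hx => Finset.sum_congr rfl fun k _ => ?_
      simp only [query, if_neg (Finset.ne_of_mem_erase hx)]
  have h2 : ∀ i : Registers d X Y, ∑ x, ∑ k, w x k * ‖ψ.2 x k i‖ ^ 2 =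
      ∑ k, w i.2.1 k * ‖ψ.2 i.2.1 k i‖ ^ 2 +
        ∑ x ∈ Finset.univ.erase i.2.1, ∑ k, w x k * ‖ψ.2 x k i‖ ^ 2 := fun i =>
    (Finset.add_sum_erase _ _ (Finset.mem_univ i.2.1)).symm
  have h3 := sum_evaluated_le hw out ψ
  simp only [normSq, mass, h1, h2, Finset.sum_add_distrib] at h3 ⊢
  linarith

end Amplitudes

/-! ### Unitaries of the adversary -/

section Unitary

variable {X K I : Type*} [Fintype I]

/-- Applying a matrix to the registers of the adversary. -/
def applyMatrix (U : Matrix I I ℂ) (ψ : Amplitudes X K I) : Amplitudes X K I :=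
  (U.mulVec ψ.1, fun x k => U.mulVec (ψ.2 x k))

theorem applyMatrix_sub (U : Matrix I I ℂ) (ψ φ : Amplitudes X K I) :
    applyMatrix U (ψ - φ) = applyMatrix U ψ - applyMatrix U φ := by
  ext <;> simp [applyMatrix, Matrix.mulVec_sub]

theorem sum_norm_sq_mulVec [DecidableEq I] (U : Matrix.unitaryGroup I ℂ) (v : I → ℂ) :
    ∑ i, ‖(U.1.mulVec v) i‖ ^ 2 = ∑ i, ‖v i‖ ^ 2 := by
  have key : ∀ v : I → ℂ, ((∑ i, ‖v i‖ ^ 2 : ℝ) : ℂ) = dotProduct (star v) v := by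
    intro v
    simp only [dotProduct, Pi.star_apply, Complex.ofReal_sum]
    refine Finset.sum_congr rfl fun i _ => ?_
    rw [RCLike.star_def, Complex.conj_mul']
    push_cast
    rfl
  have hU : (U.1).conjTranspose * U.1 = 1 := Matrix.UnitaryGroup.star_mul_self U
  have : ((∑ i, ‖(U.1.mulVec v) i‖ ^ 2 : ℝ) : ℂ) = ((∑ i, ‖v i‖ ^ 2 : ℝ) : ℂ) := by
    rw [key, key, Matrix.star_mulVec, Matrix.dotProduct_mulVec, Matrix.vecMul_vecMul, hU,
      Matrix.vecMul_one]
  exact_mod_cast this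

variable [Fintype X] [Fintype K]

theorem normSq_eq (w : X → K → ℝ) (ψ : Amplitudes X K I) :
    normSq w ψ = ∑ i, ‖ψ.1 i‖ ^ 2 + ∑ x, ∑ k, w x k * ∑ i, ‖ψ.2 x k i‖ ^ 2 := by
  simp only [normSq, mass]
  rw [Finset.sum_add_distrib, Finset.sum_comm]
  congr 1
  refine Finset.sum_congr rfl fun x _ => ?_
  rw [Finset.sum_comm]
  simp only [Finset.mul_sum]

omit [Fintype I] in
theorem mass_nonneg {w : X → K → ℝ} (hw : ∀ x k, 0 ≤ w x k) (ψ : Amplitudes X K I) (i : I) :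
    0 ≤ mass w ψ i :=
  add_nonneg (sq_nonneg _) (Finset.sum_nonneg fun x _ =>
    Finset.sum_nonneg fun k _ => mul_nonneg (hw x k) (sq_nonneg _))

theorem normSq_applyMatrix [DecidableEq I] (w : X → K → ℝ) (U : Matrix.unitaryGroup I ℂ)
    (ψ : Amplitudes X K I) : normSq w (applyMatrix U.1 ψ) = normSq w ψ := by
  simp only [normSq_eq, applyMatrix, sum_norm_sq_mulVec]

omit [Fintype I] in
theorem mass_add_le {w : X → K → ℝ} (hw : ∀ x k, 0 ≤ w x k) {s : ℝ} (hs : 0 < s)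
    (ψ φ : Amplitudes X K I) (i : I) :
    mass w (ψ + φ) i ≤ (1 + 1 / s) * mass w ψ i + (1 + s) * mass w φ i := by
  have h1 := norm_add_sq_le_of_pos hs (ψ.1 i) (φ.1 i)
  have h2 : ∑ x, ∑ k, w x k * ‖(ψ + φ).2 x k i‖ ^ 2 ≤
      (1 + 1 / s) * ∑ x, ∑ k, w x k * ‖ψ.2 x k i‖ ^ 2 +
        (1 + s) * ∑ x, ∑ k, w x k * ‖φ.2 x k i‖ ^ 2 := by
    simp only [Finset.mul_sum, ← Finset.sum_add_distrib]
    refine Finset.sum_le_sum fun x _ => Finset.sum_le_sum fun k _ => ?_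
    have := mul_le_mul_of_nonneg_left (norm_add_sq_le_of_pos hs (ψ.2 x k i) (φ.2 x k i)) (hw x k)
    simp only [Prod.snd_add, Pi.add_apply]
    linarith
  simp only [mass, Prod.fst_add, Pi.add_apply]
  linarith

theorem normSq_add_le {w : X → K → ℝ} (hw : ∀ x k, 0 ≤ w x k) {s : ℝ} (hs : 0 < s)
    (ψ φ : Amplitudes X K I) :
    normSq w (ψ + φ) ≤ (1 + 1 / s) * normSq w ψ + (1 + s) * normSq w φ := by
  simp only [normSq, Finset.mul_sum, ← Finset.sum_add_distrib]
  exact Finset.sum_le_sum fun i _ => mass_add_le hw hs ψ φ i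

end Unitary

/-! ### Expectations over the function -/

section Expectation

/-- The variance of a sum of uncorrelated variables is the sum of the variances, each at most a
second moment. -/
theorem sum_norm_sq_sum_sub_mean_le {Ω K : Type*} [Fintype Ω] [Fintype K] (P : Ω → ℝ)
    (hP : ∑ ω, P ω = 1) (g : K → Ω → ℂ)
    (uncorrelated : ∀ k l, k ≠ l → ∑ ω, (P ω : ℂ) * (g k ω * star (g l ω)) =
      (∑ ω, (P ω : ℂ) * g k ω) * star (∑ ω, (P ω : ℂ) * g l ω)) :
    ∑ ω, P ω * ‖∑ k, (g k ω - ∑ ω', (P ω' : ℂ) * g k ω')‖ ^ 2 ≤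
      ∑ k, ∑ ω, P ω * ‖g k ω‖ ^ 2 := by
  have hP' : ∑ ω, (P ω : ℂ) = 1 := by exact_mod_cast hP
  set m : K → ℂ := fun k => ∑ ω, (P ω : ℂ) * g k ω with hm
  have cross : ∀ k l, k ≠ l →
      ∑ ω, (P ω : ℂ) * ((g k ω - m k) * star (g l ω - m l)) = 0 := by
    intro k l hkl
    have hstar : ∑ ω, (P ω : ℂ) * star (g l ω) = star (m l) := by
      simp [hm]
    calc _ = ∑ ω, ((P ω : ℂ) * (g k ω * star (g l ω)) - (P ω : ℂ) * g k ω * star (m l)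
            - m k * ((P ω : ℂ) * star (g l ω)) + (P ω : ℂ) * (m k * star (m l))) :=
          Finset.sum_congr rfl fun ω _ => by rw [star_sub]; ring
      _ = 0 := by
          rw [Finset.sum_add_distrib, Finset.sum_sub_distrib, Finset.sum_sub_distrib,
            uncorrelated k l hkl, ← Finset.sum_mul, ← Finset.mul_sum, ← Finset.sum_mul, hstar, hP']
          ring
  have expand : ∑ ω, P ω * ‖∑ k, (g k ω - m k)‖ ^ 2 = ∑ k, ∑ ω, P ω * ‖g k ω - m k‖ ^ 2 := by
    have hsq : ∀ z : ℂ, ((‖z‖ ^ 2 : ℝ) : ℂ) = z * star z := by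
      intro z
      rw [RCLike.star_def, Complex.mul_conj']
      push_cast
      rfl
    have : ((∑ ω, P ω * ‖∑ k, (g k ω - m k)‖ ^ 2 : ℝ) : ℂ) =
        ((∑ k, ∑ ω, P ω * ‖g k ω - m k‖ ^ 2 : ℝ) : ℂ) := by
      simp only [Complex.ofReal_sum, Complex.ofReal_mul, hsq, star_sum, Finset.sum_mul_sum]
      simp only [Finset.mul_sum]
      rw [Finset.sum_comm]
      refine Finset.sum_congr rfl fun k _ => ?_
      rw [Finset.sum_comm, Finset.sum_eq_single k (fun l _ hl => cross k l hl.symm)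
        (fun h => absurd (Finset.mem_univ _) h)]
    exact_mod_cast this
  rw [expand]
  refine Finset.sum_le_sum fun k _ => ?_
  rw [sum_weighted_norm_sq_eq P hP (g k)]
  exact le_add_of_nonneg_left (sq_nonneg _)

variable {X : Type u} {R : Type v} {Y : Type w}
variable [Fintype X] [Fintype R] [Fintype Y] [DecidableEq X] [DecidableEq R]
variable (F : PMF (X × R → Y))

theorem sum_toReal_eq_one : ∑ f, (F f).toReal = 1 := by
  rw [← ENNReal.toReal_sum fun f _ => F.apply_ne_top f, ← tsum_fintype (L := .unconditional _),
    F.tsum_coe, ENNReal.toReal_one]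

theorem prob_nonneg (E : (X × R → Y) → Prop) : 0 ≤ prob F E :=
  Finset.sum_nonneg fun f _ => by split_ifs <;> simp

theorem sum_eval_eq (c : X × R) (h : Y → ℂ) :
    ∑ f, ((F f).toReal : ℂ) * h (f c) = ∑ y, (prob F (fun f => f c = y) : ℂ) * h y := by
  classical
  simp only [prob, Complex.ofReal_sum, Finset.sum_mul]
  rw [Finset.sum_comm]
  refine Finset.sum_congr rfl fun f _ => ?_
  rw [Finset.sum_eq_single (f c)]
  · simp
  · intro y _ hy
    simp [Ne.symm hy]
  · simp

theorem sum_eval_eq_real (c : X × R) (h : Y → ℝ) :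
    ∑ f, (F f).toReal * h (f c) = ∑ y, prob F (fun f => f c = y) * h y := by
  have := sum_eval_eq F c fun y => (h y : ℂ)
  exact_mod_cast this

theorem sum_eval_eval_eq (c c' : X × R) (h h' : Y → ℂ) :
    ∑ f, ((F f).toReal : ℂ) * (h (f c) * h' (f c')) =
      ∑ y, ∑ y', (prob F (fun f => f c = y ∧ f c' = y') : ℂ) * (h y * h' y') := by
  classical
  simp only [prob, Complex.ofReal_sum, Finset.sum_mul]
  rw [Finset.sum_congr rfl fun y _ => Finset.sum_comm, Finset.sum_comm]
  refine Finset.sum_congr rfl fun f _ => ?_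
  rw [Finset.sum_eq_single (f c), Finset.sum_eq_single (f c')]
  · simp
  · intro y _ hy
    simp [Ne.symm hy]
  · simp
  · intro y _ hy
    simp [Ne.symm hy]
  · simp

theorem sum_prob_eval_eq_one (c : X × R) : ∑ y, prob F (fun f => f c = y) = 1 := by
  have := sum_eval_eq_real F c fun _ => 1
  simpa [sum_toReal_eq_one] using this.symm

/-- Weights of the content of a database cell at `x` together with the value of the function. -/
def pairWeight (x : X) (k : R × Y) : ℝ :=
  1 / (Fintype.card R : ℝ) * prob F (fun f => f (x, k.1) = k.2)

/-- Weights of the content of a database cell. -/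
def uniformWeight (X : Type u) (R : Type v) [Fintype R] (_ : X) (_ : R) : ℝ :=
  1 / (Fintype.card R : ℝ)

theorem pairWeight_nonneg (x : X) (k : R × Y) : 0 ≤ pairWeight F x k :=
  mul_nonneg (by positivity) (prob_nonneg F _)

omit [Fintype X] [DecidableEq X] [DecidableEq R] in
theorem uniformWeight_nonneg (x : X) (r : R) : 0 ≤ uniformWeight X R x r := by
  unfold uniformWeight
  positivity

omit [Fintype X] [DecidableEq X] [DecidableEq R] in
theorem sum_uniformWeight [Nonempty R] (x : X) : ∑ r, uniformWeight X R x r = 1 := by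
  simp [uniformWeight]

theorem sum_pairWeight [Nonempty R] (x : X) : ∑ k, pairWeight F x k = 1 := by
  simp only [pairWeight, Fintype.sum_prod_type, ← Finset.mul_sum, sum_prob_eval_eq_one]
  simp

/-- Pairwise independence of the values of a random function. -/
def PairwiseIndependent : Prop :=
  ∀ (x x' : X) (r r' : R) (y y' : Y), (x, r) ≠ (x', r') →
    prob F (fun f => f (x, r) = y ∧ f (x', r') = y') =
      prob F (fun f => f (x, r) = y) * prob F (fun f => f (x', r') = y')

/-- The difference of the average over a database cell and its expectation. -/
def deviation (f : X × R → Y) (x : X) (h : R × Y → ℂ) : ℂ :=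
  ∑ r, (uniformWeight X R x r : ℂ) * h (r, f (x, r)) - ∑ k, (pairWeight F x k : ℂ) * h k

/-- The deviation is `1 / |R|` times a sum of centred variables, uncorrelated for different `r`. The
prefactor squared leaves one factor `1 / |R|` after the other is absorbed into the weights. -/
theorem sum_norm_sq_deviation_le (hF : PairwiseIndependent F) (x : X) (h : R × Y → ℂ) :
    ∑ f, (F f).toReal * ‖deviation F f x h‖ ^ 2 ≤
      1 / (Fintype.card R : ℝ) * ∑ k, pairWeight F x k * ‖h k‖ ^ 2 := by
  have key := sum_norm_sq_sum_sub_mean_le (fun f => (F f).toReal)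
    (sum_toReal_eq_one F) (fun r f => h (r, f (x, r))) (by
      intro r r' hr
      rw [sum_eval_eval_eq F (x, r) (x, r') (fun y => h (r, y)) (fun y => star (h (r', y))),
        sum_eval_eq F (x, r) (fun y => h (r, y)), sum_eval_eq F (x, r') (fun y => h (r', y)),
        star_sum, Finset.sum_mul_sum]
      refine Finset.sum_congr rfl fun y _ => Finset.sum_congr rfl fun y' _ => ?_
      rw [hF x x r r' y y' (by simpa using hr)]
      simp
      ring)
  have hdev : ∀ f, deviation F f x h = (1 / (Fintype.card R : ℝ) : ℝ) *
      ∑ r, (h (r, f (x, r)) - ∑ f', ((F f').toReal : ℂ) * h (r, f' (x, r))) := by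
    intro f
    simp only [deviation, uniformWeight, pairWeight, Fintype.sum_prod_type,
      Complex.ofReal_mul, mul_assoc, ← Finset.mul_sum, ← mul_sub, Finset.sum_sub_distrib]
    congr 2
    exact Finset.sum_congr rfl fun r _ => (sum_eval_eq F (x, r) fun y => h (r, y)).symm
  have hrhs : ∑ r, ∑ f, (F f).toReal * ‖h (r, f (x, r))‖ ^ 2 =
      ∑ r, ∑ y, prob F (fun f => f (x, r) = y) * ‖h (r, y)‖ ^ 2 :=
    Finset.sum_congr rfl fun r _ => sum_eval_eq_real F (x, r) fun y => ‖h (r, y)‖ ^ 2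
  rw [hrhs] at key
  simp only [hdev, norm_mul, mul_pow, Complex.norm_real, Real.norm_eq_abs, sq_abs, pairWeight,
    Fintype.sum_prod_type, mul_left_comm _ ((1 / (Fintype.card R : ℝ)) ^ 2), mul_assoc,
    ← Finset.mul_sum]
  rw [sq, mul_assoc]
  gcongr

end Expectation

/-! ### Comparison with amplitudes that do not depend on the function -/

section Comparison

variable {X : Type u} {R : Type v} {Y : Type w} {d : ℕ}
variable [Fintype X] [Fintype R] [Fintype Y] [DecidableEq X] [DecidableEq R]

/-- Specializing amplitudes labelled by a database content and a value to the values of `f`. -/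
def specialize {I : Type*} (f : X × R → Y) (ψ : Amplitudes X (R × Y) I) : Amplitudes X R I :=
  (ψ.1, fun x r i => ψ.2 x (r, f (x, r)) i)

omit [Fintype X] [Fintype R] [Fintype Y] [DecidableEq X] [DecidableEq R] in
theorem specialize_applyMatrix {I : Type*} [Fintype I] (U : Matrix I I ℂ) (f : X × R → Y)
    (ψ : Amplitudes X (R × Y) I) :
    specialize f (applyMatrix U ψ) = applyMatrix U (specialize f ψ) := rfl

variable [AddCommGroup Y]

/-- A query for the function `f`. -/
abbrev functionQuery (f : X × R → Y) :
    Amplitudes X R (Registers d X Y) → Amplitudes X R (Registers d X Y) :=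
  query (uniformWeight X R) (fun x r => f (x, r))

/-- A query in which the value of the function is part of the database. -/
abbrev pairQuery (F : PMF (X × R → Y)) :
    Amplitudes X (R × Y) (Registers d X Y) → Amplitudes X (R × Y) (Registers d X Y) :=
  query (pairWeight F) (fun _ k => k.2)

/-- Here `δ` is the error of the average in decompression and `η` that in compression. With `e` the
error on the empty database, the left side is at most `3 ‖e‖² + 2 ∑ w ‖δ‖²`, and `‖e‖² ≤ 2 ‖η‖² + 2
∑ w ‖δ‖²`. -/
theorem sum_weighted_norm_sq_sub_query_error {K : Type*} [Fintype K] (w : K → ℝ)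
    (hw0 : ∀ k, 0 ≤ w k) (hw : ∑ k, w k = 1) (δ : K → ℂ) (η : ℂ) :
    ‖η - ∑ k, (w k : ℂ) * δ k‖ ^ 2 +
        ∑ k, w k * ‖-δ k - (η - ∑ k, (w k : ℂ) * δ k)‖ ^ 2 ≤
      6 * ‖η‖ ^ 2 + 8 * ∑ k, w k * ‖δ k‖ ^ 2 := by
  set e := η - ∑ k, (w k : ℂ) * δ k with he
  have h1 : ‖e‖ ^ 2 ≤ 2 * ‖η‖ ^ 2 + 2 * ∑ k, w k * ‖δ k‖ ^ 2 := by
    have := norm_add_sq_le_two_mul η (-∑ k, (w k : ℂ) * δ k)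
    rw [← sub_eq_add_neg, norm_neg, ← he] at this
    linarith [norm_sq_sum_weighted_le w hw0 hw δ]
  have h2 : ∑ k, w k * ‖-δ k - e‖ ^ 2 ≤ 2 * ∑ k, w k * ‖δ k‖ ^ 2 + 2 * ‖e‖ ^ 2 := by
    calc ∑ k, w k * ‖-δ k - e‖ ^ 2
        ≤ ∑ k, (2 * (w k * ‖δ k‖ ^ 2) + 2 * ‖e‖ ^ 2 * w k) := by
          refine Finset.sum_le_sum fun k _ => ?_
          have h3 := norm_add_sq_le_two_mul (-δ k) (-e)
          rw [← sub_eq_add_neg, norm_neg, norm_neg] at h3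
          linarith [mul_le_mul_of_nonneg_left h3 (hw0 k)]
      _ = _ := by rw [Finset.sum_add_distrib, ← Finset.mul_sum, ← Finset.mul_sum, hw, mul_one]
  linarith

/-- The two queries differ only in their averages, and `ψ` is independent of `f`, so both deviations
are those of fixed functions on `R × Y`. The constant is `6 + 8`. -/
theorem sum_normSq_functionQuery_sub_le [Nonempty R] (F : PMF (X × R → Y))
    (hF : PairwiseIndependent F) (ψ : Amplitudes X (R × Y) (Registers d X Y)) :
    ∑ f, (F f).toReal * normSq (uniformWeight X R)
        (functionQuery f (specialize f ψ) - specialize f (pairQuery F ψ)) ≤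
      14 / (Fintype.card R : ℝ) * normSq (pairWeight F) ψ := by
  set δ : (X × R → Y) → Registers d X Y → ℂ := fun f i =>
    deviation F f i.2.1 fun k => ψ.2 i.2.1 k i with hδ
  set η : (X × R → Y) → Registers d X Y → ℂ := fun f i =>
    deviation F f i.2.1 fun k => evaluated (pairWeight F) (fun _ k => k.2) ψ k i with hη
  set T : (X × R → Y) → R → Registers d X Y ≃ Registers d X Y := fun f r =>
    unshift fun x => f (x, r) with hT
  have heval : ∀ f r i,
      evaluated (uniformWeight X R) (fun x r => f (x, r)) (specialize f ψ) r i =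
        evaluated (pairWeight F) (fun _ k => k.2) ψ (r, f (i.2.1, r)) i - δ f (T f r i) := by
    intro f r i
    simp only [evaluated, decompressed, specialize, hδ, hT, deviation, unshift_input]
    have : unshift (fun _ => f (i.2.1, r)) i = unshift (fun x => f (x, r)) i := rfl
    simp only [this]
    ring
  have hpoint : ∀ f, normSq (uniformWeight X R)
        (functionQuery f (specialize f ψ) - specialize f (pairQuery F ψ)) ≤
      6 * ∑ i, ‖η f i‖ ^ 2 + 8 * ∑ i, ‖δ f i‖ ^ 2 := by
    intro f
    -- The shift by `f (x, r)` permutes the registers without changing the query input.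
    have hreindex : ∑ i, ∑ r, uniformWeight X R i.2.1 r * ‖δ f (T f r i)‖ ^ 2 =
        ∑ i, ‖δ f i‖ ^ 2 := by
      rw [Finset.sum_comm]
      have : ∀ r, ∑ i, uniformWeight X R i.2.1 r * ‖δ f (T f r i)‖ ^ 2 =
          ∑ i, uniformWeight X R i.2.1 r * ‖δ f i‖ ^ 2 := fun r =>
        (T f r).sum_comp fun i => uniformWeight X R i.2.1 r * ‖δ f i‖ ^ 2
      rw [Finset.sum_congr rfl fun r _ => this r, Finset.sum_comm]
      simp only [← Finset.sum_mul, sum_uniformWeight, one_mul]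
    rw [← hreindex, Finset.mul_sum, Finset.mul_sum, ← Finset.sum_add_distrib]
    refine Finset.sum_le_sum fun i _ => ?_
    have hfst : (functionQuery f (specialize f ψ) - specialize f (pairQuery F ψ)).1 i =
        η f i - ∑ r, (uniformWeight X R i.2.1 r : ℂ) * δ f (T f r i) := by
      simp only [Prod.fst_sub, Pi.sub_apply, query, heval, mul_sub, Finset.sum_sub_distrib]
      simp only [specialize, hη, deviation]
      ring
    have hsnd : ∀ r, (functionQuery f (specialize f ψ) - specialize f (pairQuery F ψ)).2 i.2.1 r i =
        -δ f (T f r i) - (η f i - ∑ r, (uniformWeight X R i.2.1 r : ℂ) * δ f (T f r i)) := by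
      intro r
      rw [← hfst]
      simp only [Prod.snd_sub, Prod.fst_sub, Pi.sub_apply, query, if_true, heval]
      simp only [specialize, if_true]
      ring
    rw [mass, Finset.sum_eq_single i.2.1]
    · rw [hfst]
      simp only [hsnd]
      exact sum_weighted_norm_sq_sub_query_error _ (uniformWeight_nonneg _)
        (sum_uniformWeight _) _ _
    · intro x _ hx
      refine Finset.sum_eq_zero fun r _ => ?_
      simp [query, specialize, hx]
    · simp
  have hN : (0 : ℝ) ≤ 1 / (Fintype.card R : ℝ) := by positivity
  have hηsum : ∑ f, (F f).toReal * ∑ i, ‖η f i‖ ^ 2 ≤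
      1 / (Fintype.card R : ℝ) * normSq (pairWeight F) ψ := by
    simp only [Finset.mul_sum]
    rw [Finset.sum_comm]
    calc _ ≤ ∑ i : Registers d X Y, 1 / (Fintype.card R : ℝ) *
          ∑ k, pairWeight F i.2.1 k *
            ‖evaluated (pairWeight F) (fun _ k => k.2) ψ k i‖ ^ 2 :=
          Finset.sum_le_sum fun i _ => sum_norm_sq_deviation_le F hF _ _
      _ ≤ _ := by
          rw [← Finset.mul_sum]
          refine mul_le_mul_of_nonneg_left
            ((sum_evaluated_le (sum_pairWeight F) _ ψ).trans ?_) hN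
          refine Finset.sum_le_sum fun i _ => add_le_add_right ?_ _
          exact Finset.single_le_sum (f := fun x => ∑ k, pairWeight F x k * ‖ψ.2 x k i‖ ^ 2)
            (fun x _ => Finset.sum_nonneg fun k _ =>
              mul_nonneg (pairWeight_nonneg F x k) (sq_nonneg _)) (Finset.mem_univ _)
  have hδsum : ∑ f, (F f).toReal * ∑ i, ‖δ f i‖ ^ 2 ≤
      1 / (Fintype.card R : ℝ) * normSq (pairWeight F) ψ := by
    simp only [Finset.mul_sum]
    rw [Finset.sum_comm]
    calc _ ≤ ∑ i : Registers d X Y, 1 / (Fintype.card R : ℝ) *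
          ∑ k, pairWeight F i.2.1 k * ‖ψ.2 i.2.1 k i‖ ^ 2 :=
          Finset.sum_le_sum fun i _ => sum_norm_sq_deviation_le F hF _ _
      _ ≤ _ := by
          rw [← Finset.mul_sum]
          refine mul_le_mul_of_nonneg_left (Finset.sum_le_sum fun i _ => ?_) hN
          refine (Finset.single_le_sum (f := fun x => ∑ k, pairWeight F x k * ‖ψ.2 x k i‖ ^ 2)
            (fun x _ => Finset.sum_nonneg fun k _ =>
              mul_nonneg (pairWeight_nonneg F x k) (sq_nonneg _)) (Finset.mem_univ _)).trans ?_
          exact le_add_of_nonneg_left (sq_nonneg _)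
  calc _ ≤ ∑ f, (F f).toReal * (6 * ∑ i, ‖η f i‖ ^ 2 + 8 * ∑ i, ‖δ f i‖ ^ 2) :=
        Finset.sum_le_sum fun f _ => mul_le_mul_of_nonneg_left (hpoint f) ENNReal.toReal_nonneg
    _ = 6 * ∑ f, (F f).toReal * ∑ i, ‖η f i‖ ^ 2 +
          8 * ∑ f, (F f).toReal * ∑ i, ‖δ f i‖ ^ 2 := by
        rw [Finset.mul_sum, Finset.mul_sum, ← Finset.sum_add_distrib]
        exact Finset.sum_congr rfl fun f _ => by ring
    _ ≤ 6 * (1 / (Fintype.card R : ℝ) * normSq (pairWeight F) ψ) +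
          8 * (1 / (Fintype.card R : ℝ) * normSq (pairWeight F) ψ) := by gcongr
    _ = _ := by ring

end Comparison

/-! ### Runs of an adversary on amplitudes -/

section Run

variable {X : Type u} {R : Type v} {Y : Type w}
variable [Fintype X] [Fintype R] [Fintype Y] [DecidableEq X] [DecidableEq R] [DecidableEq Y]
variable [AddCommGroup Y]

/-- The amplitudes after a number of queries. -/
def Adversary.run {K : Type*} [Fintype K] (A : Adversary X R Y) (w : X → K → ℝ)
    (out : X → K → Y) : ℕ → Amplitudes X K (Registers A.workDim X Y)
  | 0 => (A.init, 0)
  | t + 1 => applyMatrix (A.step t).1 (query w out (A.run w out t))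

/-- The amplitudes for the function `f`. -/
abbrev Adversary.functionRun (A : Adversary X R Y) (f : X × R → Y) :
    ℕ → Amplitudes X R (Registers A.workDim X Y) :=
  A.run (uniformWeight X R) (fun x r => f (x, r))

/-- The amplitudes if the value of the function is part of the database. -/
abbrev Adversary.pairRun (A : Adversary X R Y) (F : PMF (X × R → Y)) :
    ℕ → Amplitudes X (R × Y) (Registers A.workDim X Y) :=
  A.run (pairWeight F) (fun _ k => k.2)

omit [Fintype R] [DecidableEq R] in
theorem Adversary.normSq_run_le {K : Type*} [Fintype K] (A : Adversary X R Y)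
    {w : X → K → ℝ} (hw : ∀ x, ∑ k, w x k = 1) (out : X → K → Y) (t : ℕ) :
    normSq w (A.run w out t) ≤ 1 := by
  induction t with
  | zero => simp [Adversary.run, normSq, mass, A.init_norm]
  | succ t ih =>
    rw [Adversary.run, normSq_applyMatrix]
    exact (normSq_query_le hw out _).trans ih

omit [Fintype R] [DecidableEq R] in
theorem Adversary.run_mean_eq_zero {K : Type*} [Fintype K] (A : Adversary X R Y)
    {w : X → K → ℝ} (hw : ∀ x, ∑ k, w x k = 1) (out : X → K → Y) (t : ℕ) :
    ∀ x i, ∑ k, (w x k : ℂ) * (A.run w out t).2 x k i = 0 := by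
  induction t with
  | zero => simp [Adversary.run]
  | succ t ih =>
    intro x i
    simp only [Adversary.run, applyMatrix, Matrix.mulVec, dotProduct, Finset.mul_sum]
    rw [Finset.sum_comm]
    refine Finset.sum_eq_zero fun j _ => ?_
    have := query_mean_eq_zero hw out ih x j
    calc _ = (A.step t).1 i j * ∑ k, (w x k : ℂ) * (query w out (A.run w out t)).2 x k j := by
          rw [Finset.mul_sum]
          exact Finset.sum_congr rfl fun k _ => by ring
      _ = 0 := by rw [this, mul_zero]

/-- The old error passes through a linear norm-nonincreasing query, and one fresh query error is
added. -/
theorem Adversary.sum_normSq_functionRun_sub_le [Nonempty R] (A : Adversary X R Y)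
    (F : PMF (X × R → Y)) (hF : PairwiseIndependent F) (t : ℕ) :
    ∑ f, (F f).toReal * normSq (uniformWeight X R)
        (A.functionRun f t - specialize f (A.pairRun F t)) ≤
      t * (t + 1) * (14 / (Fintype.card R : ℝ)) := by
  induction t with
  | zero =>
    have : ∀ f, A.functionRun f 0 - specialize f (A.pairRun F 0) = 0 := by
      intro f
      ext <;> simp [Adversary.run, specialize]
    simp [this, normSq, mass]
  | succ t ih =>
    -- The parameter `s = t + 1` closes the induction: `(1 + 1/(t+1)) t (t+1) + (t+2) = (t+1)
    -- (t+2)`.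
    have hs : (0 : ℝ) < t + 1 := by positivity
    have hstep : ∀ f, normSq (uniformWeight X R)
        (A.functionRun f (t + 1) - specialize f (A.pairRun F (t + 1))) ≤
      (1 + 1 / (t + 1 : ℝ)) * normSq (uniformWeight X R)
          (A.functionRun f t - specialize f (A.pairRun F t)) +
        (1 + (t + 1 : ℝ)) * normSq (uniformWeight X R)
          (functionQuery f (specialize f (A.pairRun F t)) -
            specialize f (pairQuery F (A.pairRun F t))) := by
      intro f
      rw [Adversary.functionRun, Adversary.pairRun, Adversary.run, Adversary.run,
        specialize_applyMatrix, ← applyMatrix_sub, normSq_applyMatrix]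
      have := normSq_add_le (uniformWeight_nonneg (X := X) (R := R)) hs
        (functionQuery f (A.functionRun f t) - functionQuery f (specialize f (A.pairRun F t)))
        (functionQuery f (specialize f (A.pairRun F t)) -
            specialize f (pairQuery F (A.pairRun F t)))
      rw [sub_add_sub_cancel, ← query_sub] at this
      refine this.trans (add_le_add_left ?_ _)
      exact mul_le_mul_of_nonneg_left (normSq_query_le sum_uniformWeight _ _) (by positivity)
    have herr := (sum_normSq_functionQuery_sub_le F hF (A.pairRun F t)).trans
      (mul_le_of_le_one_right (by positivity) (A.normSq_run_le (sum_pairWeight F) _ t))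
    calc _ ≤ ∑ f, (F f).toReal * ((1 + 1 / (t + 1 : ℝ)) * normSq (uniformWeight X R)
            (A.functionRun f t - specialize f (A.pairRun F t)) +
          (1 + (t + 1 : ℝ)) * normSq (uniformWeight X R)
            (functionQuery f (specialize f (A.pairRun F t)) -
              specialize f (pairQuery F (A.pairRun F t)))) :=
          Finset.sum_le_sum fun f _ =>
            mul_le_mul_of_nonneg_left (hstep f) ENNReal.toReal_nonneg
      _ = (1 + 1 / (t + 1 : ℝ)) * ∑ f, (F f).toReal * normSq (uniformWeight X R)
            (A.functionRun f t - specialize f (A.pairRun F t)) +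
          (1 + (t + 1 : ℝ)) * ∑ f, (F f).toReal * normSq (uniformWeight X R)
            (functionQuery f (specialize f (A.pairRun F t)) -
              specialize f (pairQuery F (A.pairRun F t))) := by
          rw [Finset.mul_sum, Finset.mul_sum, ← Finset.sum_add_distrib]
          exact Finset.sum_congr rfl fun f _ => by ring
      _ ≤ (1 + 1 / (t + 1 : ℝ)) * (t * (t + 1) * (14 / (Fintype.card R : ℝ))) +
          (1 + (t + 1 : ℝ)) * (14 / (Fintype.card R : ℝ)) := by gcongr
      _ = _ := by
          push_cast
          field_simp
          ring

end Run

/-! ### The oracle on states with at most one database entry -/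

section Representation

variable {X : Type u} {R : Type v} {Y : Type w} {d : ℕ}
variable [Fintype R] [DecidableEq R] [DecidableEq X]

/-- The database in which only the cell at `x` may be nonempty. -/
def cell (x : X) (o : Option R) : Database X R := Function.update (fun _ => none) x o

omit [Fintype R] [DecidableEq R] in
theorem cell_none (x : X) : cell x (none : Option R) = fun _ => none := by
  simp [cell]

omit [Fintype R] [DecidableEq R] in
theorem cell_some_ne (x : X) (r : R) : cell x (some r) ≠ fun _ => none := fun h => by
  simpa [cell] using congrFun h x

omit [Fintype R] [DecidableEq R] in
theorem cell_some_inj {x x' : X} {r r' : R} (h : cell x (some r) = cell x' (some r')) :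
    x = x' ∧ r = r' := by
  have h1 := congrFun h x
  by_cases hx : x = x'
  · subst hx
    simpa [cell] using h1
  · simp [cell, hx] at h1

omit [DecidableEq R] in
theorem inv_sqrt_card_mul_self :
    ((1 / √(Fintype.card R : ℝ) : ℝ) : ℂ) * ((1 / √(Fintype.card R : ℝ) : ℝ) : ℂ) =
      1 / (Fintype.card R : ℂ) := by
  rw [← Complex.ofReal_mul, div_mul_div_comm, Real.mul_self_sqrt (Nat.cast_nonneg _)]
  simp

theorem sum_decompCell_mul_decompCell [Nonempty R] (a c : Option R) :
    ∑ o, decompCell a o * decompCell o c = if a = c then 1 else 0 := by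
  have hN : (Fintype.card R : ℂ) ≠ 0 := by simp
  have hs := inv_sqrt_card_mul_self (R := R)
  rw [Fintype.sum_option]
  rcases a with _ | a <;> rcases c with _ | c
  · simp only [decompCell, hs]
    simp
  · simp [decompCell, ← Finset.mul_sum]
  · simp [decompCell, ← Finset.sum_mul]
  · simp only [decompCell, hs, sub_mul, mul_sub, Finset.sum_sub_distrib, Option.some_inj]
    simp

theorem decomp_decomp [Nonempty R] (ψ : Extended X R Y → ℂ) : decomp (decomp ψ) = ψ := by
  funext ⟨⟨x, u, b⟩, s, D⟩
  simp only [decomp, Function.update_self, Function.update_idem, Finset.mul_sum]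
  rw [Finset.sum_comm]
  simp only [← mul_assoc, ← Finset.sum_mul, sum_decompCell_mul_decompCell]
  rw [Finset.sum_eq_single (D x)]
  · simp
  · intro o _ ho
    simp [Ne.symm ho]
  · simp

/-- Decompression of the cell at the query input, without scratch register. -/
def decompressCell (φ : Query X Y × Database X R → ℂ) : Query X Y × Database X R → ℂ :=
  fun (q, D) => ∑ o, decompCell (D q.1) o * φ (q, Function.update D q.1 o)

variable [AddCommGroup R] [AddCommGroup Y]

/-- Evaluation of `f` touches neither the query input nor the database, so it commutes with `decomp`
and the two inner decompressions cancel. The scratch register then merely copies the cell content,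
with `⊥` read as `0`. -/
theorem answer_apply (f : X × R → Y) (φ : Query X Y × Database X R → ℂ) (x : X) (u : Y) (b : Bool)
    (D : Database X R) : answer f φ ((x, u, b), D) =
      ∑ o, decompCell (D x) o *
        decompressCell φ ((x, u - f (x, o.getD 0), !b), Function.update D x o) := by
  have hcomm : ∀ ψ : Extended X R Y → ℂ, decomp (basisMap (evalFunction f) (decomp ψ)) =
      basisMap (evalFunction f) ψ := by
    intro ψ
    have : ∀ ψ : Extended X R Y → ℂ, decomp (basisMap (evalFunction f) ψ) =
        basisMap (evalFunction f) (decomp ψ) := fun ψ => rfl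
    rw [this, decomp_decomp]
  simp only [answer, compressedUnquery, compressedQuery, hcomm]
  simp only [decomp, basisMap, decompressCell, readDatabase, evalFunction, Equiv.symm,
    Equiv.coe_fn_mk, Function.update_self, zero_add, sub_self, if_true]

omit [AddCommGroup R] [AddCommGroup Y] in
theorem decompressCell_eq_zero (φ : Query X Y × Database X R → ℂ) (x : X) (u : Y) (b : Bool)
    (D : Database X R) (o : Option R) (hφ : ∀ p, ¬ Answerable p → φ p = 0)
    (hD : ∃ x', x' ≠ x ∧ D x' ≠ none) :
    decompressCell φ ((x, u, b), Function.update D x o) = 0 := by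
  obtain ⟨x', hx, hD⟩ := hD
  refine Finset.sum_eq_zero fun o' _ => ?_
  rw [hφ, mul_zero]
  intro h
  have := h x' hx
  simp [Function.update_of_ne hx] at this
  exact hD this

theorem seqOracle_of_ne (f : X × R → Y) (φ : Query X Y × Database X R → ℂ) (x : X) (u : Y)
    (b : Bool) (D : Database X R) (hD : ∃ x', x' ≠ x ∧ D x' ≠ none) :
    seqOracle f φ ((x, u, b), D) = φ ((x, u, b), D) := by
  have hnot : ¬ Answerable ((x, u, b), D) := fun h => hD.elim fun x' hx => hx.2 (h x' hx.1)
  rw [seqOracle, if_neg hnot, answer_apply, Finset.sum_eq_zero, zero_add]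
  intro o _
  rw [decompressCell_eq_zero _ _ _ _ _ _ (fun p hp => if_neg hp) hD, mul_zero]

theorem seqOracle_cell (f : X × R → Y) (φ : Query X Y × Database X R → ℂ) (x : X) (u : Y)
    (b : Bool) (o : Option R) : seqOracle f φ ((x, u, b), cell x o) =
      ∑ o', decompCell o o' * ∑ o'', decompCell o' o'' *
        φ ((x, u - f (x, o'.getD 0), !b), cell x o'') := by
  have hans : ∀ (u : Y) (b : Bool) (o : Option R), Answerable ((x, u, b), cell x o) :=
    fun u b o x' hx => by simp [cell, Function.update_of_ne hx]
  rw [seqOracle, if_pos (hans u b o), answer_apply, add_zero]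
  generalize hφ' :
    (fun p' => @ite _ (Answerable p') (Classical.propDecidable _) (φ p') 0) = φ'
  have hφ'' : ∀ (u : Y) (b : Bool) (o : Option R),
      φ' ((x, u, b), cell x o) = φ ((x, u, b), cell x o) := by
    intro u b o
    rw [← hφ']
    exact if_pos (hans u b o)
  have hself : ∀ o : Option R, cell x o x = o := fun o => Function.update_self _ _ _
  have hupd : ∀ o o' : Option R, Function.update (cell x o) x o' = cell x o' :=
    fun o o' => Function.update_idem _ _ _
  simp only [decompressCell, hself, hupd, hφ'']

/-- A joint state with at most one database entry is given by amplitudes. -/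
structure Represents {I : Type*} (ψ : I × Database X R → ℂ) (A : Amplitudes X R I) : Prop where
  empty : ∀ i, ψ (i, fun _ => none) = A.1 i
  single : ∀ i x r, ψ (i, cell x (some r)) = ((1 / √(Fintype.card R : ℝ) : ℝ) : ℂ) * A.2 x r i
  other : ∀ i D, (D ≠ fun _ => none) → (∀ x r, D ≠ cell x (some r)) → ψ (i, D) = 0

omit [AddCommGroup R] [AddCommGroup Y] in
-- Since no `⊥` part survives decompression, the convention of evaluating `f (x, 0)` on `⊥` never
-- matters.
theorem Represents.decompress_none {ψ : Registers d X Y × Database X R → ℂ}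
    {A : Amplitudes X R (Registers d X Y)} (h : Represents ψ A)
    (hA : ∀ x i, ∑ r, (uniformWeight X R x r : ℂ) * A.2 x r i = 0) (x : X)
    (i : Registers d X Y) :
    ∑ o, decompCell none o * ψ (i, cell x o) = 0 := by
  have h1 := hA x i
  rw [Fintype.sum_option]
  simp only [decompCell, h.single, ← mul_assoc, inv_sqrt_card_mul_self, zero_mul, zero_add]
  simpa [uniformWeight] using h1

omit [AddCommGroup R] [AddCommGroup Y] in
theorem Represents.decompress_some {ψ : Registers d X Y × Database X R → ℂ}
    {A : Amplitudes X R (Registers d X Y)} (h : Represents ψ A) (r : R)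
    (i : Registers d X Y) :
    ∑ o, decompCell (some r) o * ψ (i, cell i.2.1 o) =
      ((1 / √(Fintype.card R : ℝ) : ℝ) : ℂ) * decompressed (uniformWeight X R) A r i := by
  rw [Fintype.sum_option]
  simp only [decompCell, h.single, cell_none, h.empty, decompressed, uniformWeight, sub_mul,
    Finset.sum_sub_distrib, ite_mul, one_mul, zero_mul, Finset.sum_ite_eq, Finset.mem_univ,
    if_true, mul_sub, mul_add]
  have : ((1 / (Fintype.card R : ℝ) : ℝ) : ℂ) = 1 / (Fintype.card R : ℂ) := by simp
  simp only [this, Finset.mul_sum, mul_left_comm (1 / (Fintype.card R : ℂ))]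
  ring

theorem Represents.seqOracle {ψ : Registers d X Y × Database X R → ℂ}
    {A : Amplitudes X R (Registers d X Y)} (h : Represents ψ A)
    (hA : ∀ x i, ∑ r, (uniformWeight X R x r : ℂ) * A.2 x r i = 0) (f : X × R → Y) :
    Represents (fun p => seqOracle f (fun p' => ψ ((p.1.1, p'.1), p'.2)) (p.1.2, p.2))
      (functionQuery f A) := by
  have hcell : ∀ (z : Fin d) (x : X) (u : Y) (b : Bool) (o : Option R),
      SEQ.seqOracle f (fun p' => ψ ((z, p'.1), p'.2)) ((x, u, b), cell x o) =
        ∑ r, decompCell o (some r) * (((1 / √(Fintype.card R : ℝ) : ℝ) : ℂ) *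
          evaluated (uniformWeight X R) (fun x r => f (x, r)) A r (z, x, u, b)) := by
    intro z x u b o
    rw [seqOracle_cell, Fintype.sum_option]
    dsimp only
    rw [h.decompress_none hA, mul_zero, zero_add]
    exact Finset.sum_congr rfl fun r _ =>
      congrArg _ (h.decompress_some r (z, x, u - f (x, r), !b))
  have hcard : ∀ (x : X) (r : R), (uniformWeight X R x r : ℂ) = 1 / (Fintype.card R : ℂ) := by
    intro x r
    simp [uniformWeight]
  refine ⟨?_, ?_, ?_⟩
  · rintro ⟨z, x, u, b⟩
    have := hcell z x u b none
    rw [cell_none] at this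
    refine this.trans ?_
    simp only [decompCell, ← mul_assoc, inv_sqrt_card_mul_self, query, hcard]
  · rintro ⟨z, x, u, b⟩ x' r
    by_cases hx : x' = x
    · subst hx
      refine (hcell z x' u b (some r)).trans ?_
      simp only [decompCell, query, if_true, hcard, sub_mul, ite_mul, one_mul, zero_mul,
        Finset.sum_sub_distrib, Finset.sum_ite_eq, Finset.mem_univ, mul_sub, Finset.mul_sum,
        mul_left_comm (1 / (Fintype.card R : ℂ))]
    · have hne : ∃ x'', x'' ≠ x ∧ cell x' (some r) x'' ≠ none := ⟨x', hx, by simp [cell]⟩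
      refine (seqOracle_of_ne f _ x u b _ hne).trans ?_
      simp only [query, if_neg hx, h.single]
  · rintro ⟨z, x, u, b⟩ D hD hD'
    -- A database that is neither empty nor a single entry at the query input has an entry
    -- elsewhere, so the oracle does nothing.
    have hne : ∃ x', x' ≠ x ∧ D x' ≠ none := by
      by_contra! hcon
      have hDx : D = cell x (D x) := by
        funext x'
        by_cases hx : x' = x
        · subst hx
          simp [cell]
        · simp [cell, hx, hcon x' hx]
      rcases ho : D x with _ | r
      · rw [ho, cell_none] at hDx
        exact hD hDx
      · rw [ho] at hDx
        exact hD' x r hDx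
    refine (seqOracle_of_ne f _ x u b _ hne).trans ?_
    exact h.other _ _ hD hD'

omit [DecidableEq R] [AddCommGroup R] in
theorem Represents.applyMatrix {I : Type*} [Fintype I] {ψ : I × Database X R → ℂ}
    {A : Amplitudes X R I} (h : Represents ψ A) (U : Matrix I I ℂ) :
    Represents (fun p => ∑ j, U p.1 j * ψ (j, p.2)) (applyMatrix U A) where
  empty i := by simp only [h.empty, SEQ.applyMatrix, Matrix.mulVec, dotProduct]
  single i x r := by
    simp only [h.single, SEQ.applyMatrix, Matrix.mulVec, dotProduct, Finset.mul_sum]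
    exact Finset.sum_congr rfl fun j _ => by ring
  other i D hD hD' := by simp only [h.other _ D hD hD', mul_zero, Finset.sum_const_zero]

omit [DecidableEq R] [AddCommGroup R] in
-- Databases with at most one entry are indexed by `Option (X × R)`, and the squared factor `1 /
-- √|R|` is the uniform weight.
theorem Represents.sum_norm_sq [Fintype X] {I : Type*} {ψ : I × Database X R → ℂ}
    {A : Amplitudes X R I} (h : Represents ψ A) (i : I) :
    ∑ D, ‖ψ (i, D)‖ ^ 2 = mass (uniformWeight X R) A i := by
  let e : Option (X × R) → Database X R := fun c =>
    c.elim (fun _ => none) fun p => cell p.1 (some p.2)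
  have he : Function.Injective e := by
    rintro (_ | ⟨x, r⟩) (_ | ⟨x', r'⟩) hc
    · rfl
    · exact absurd hc.symm (cell_some_ne x' r')
    · exact absurd hc (cell_some_ne x r)
    · obtain ⟨rfl, rfl⟩ := cell_some_inj hc
      rfl
  rw [← Fintype.sum_of_injective e he (fun c => ‖ψ (i, e c)‖ ^ 2) _ ?_ fun _ => rfl]
  · rw [Fintype.sum_option, Fintype.sum_prod_type]
    simp only [e, Option.elim, h.empty, h.single, mass, norm_mul, mul_pow, uniformWeight,
      Complex.norm_real, Real.norm_eq_abs, sq_abs, div_pow, one_pow,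
      Real.sq_sqrt (Nat.cast_nonneg _)]
  · intro D hD
    rw [h.other i D, norm_zero, zero_pow two_ne_zero]
    · rintro rfl
      exact hD ⟨none, rfl⟩
    · rintro x r rfl
      exact hD ⟨some (x, r), rfl⟩

variable [Fintype X] [Fintype Y] [DecidableEq Y]

theorem Adversary.represents_state (A : Adversary X R Y) (f : X × R → Y) (t : ℕ) :
    Represents (A.state f t) (A.functionRun f t) := by
  induction t with
  | zero =>
    refine ⟨fun i => if_pos rfl, fun i x r => ?_, fun i D hD _ => if_neg hD⟩
    exact (if_neg (cell_some_ne x r)).trans (by simp [Adversary.run])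
  | succ t ih =>
    exact (ih.seqOracle (A.run_mean_eq_zero sum_uniformWeight _ t) f).applyMatrix (A.step t).1

open scoped Classical in
theorem Adversary.winProbFor_eq (A : Adversary X R Y) (f : X × R → Y) :
    A.winProbFor f = ∑ i, (if Wins f (A.output i) then 1 else 0) *
      mass (uniformWeight X R) (A.functionRun f A.numQueries) i := by
  rw [Adversary.winProbFor, Fintype.sum_prod_type]
  refine Finset.sum_congr rfl fun i _ => ?_
  rw [← (A.represents_state f A.numQueries).sum_norm_sq i, Finset.mul_sum]
  exact Finset.sum_congr rfl fun D _ => by simp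

end Representation

/-! ### The winning probability -/

section Winning

variable {X : Type u} {R : Type v} {Y : Type w}
variable [Fintype X] [Fintype R] [Fintype Y] [DecidableEq X] [DecidableEq R]

open scoped Classical in
-- A winning output has two distinct input pairs, so one of them is not `(x, r)`. Its value is
-- independent of `f (x, r)`, hence of `h (f (x, r))`, and is hit with probability at most `ν`.
theorem sum_wins_mul_le (F : PMF (X × R → Y)) (hF : PairwiseIndependent F) {ν : ℝ}
    (hν : ∀ x r y, prob F (fun f => f (x, r) = y) ≤ ν) (o : (X × R × Y) × (X × R × Y))
    (x : X) (r : R) (h : Y → ℝ) (h0 : ∀ y, 0 ≤ h y) :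
    ∑ f, (F f).toReal * ((if Wins f o then 1 else 0) * h (f (x, r))) ≤
      ν * ∑ y, prob F (fun f => f (x, r) = y) * h y := by
  have hν0 : 0 ≤ ν := (prob_nonneg F _).trans (hν x r (o.1.2.2))
  by_cases ho : (o.1.1, o.1.2.1) = (o.2.1, o.2.2.1)
  · have hlose : ∀ f, ¬ Wins f o := fun f hf => hf.1 ho
    simp only [hlose, if_false, zero_mul, mul_zero, Finset.sum_const_zero]
    exact mul_nonneg hν0 (Finset.sum_nonneg fun y _ => mul_nonneg (prob_nonneg F _) (h0 y))
  obtain ⟨x', r', y', hne, hwins⟩ :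
      ∃ x' r' y', (x, r) ≠ (x', r') ∧ ∀ f, Wins f o → f (x', r') = y' := by
    by_cases hxr : (x, r) = (o.1.1, o.1.2.1)
    · exact ⟨o.2.1, o.2.2.1, o.2.2.2, hxr ▸ ho, fun f hf => hf.2.2⟩
    · exact ⟨o.1.1, o.1.2.1, o.1.2.2, hxr, fun f hf => hf.2.1⟩
  have hjoint : ∑ f, (F f).toReal * (h (f (x, r)) * if f (x', r') = y' then 1 else 0) =
      ∑ y, prob F (fun f => f (x, r) = y ∧ f (x', r') = y') * h y := by
    have := sum_eval_eval_eq F (x, r) (x', r') (fun y => (h y : ℂ))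
      (fun y => ((if y = y' then 1 else 0 : ℝ) : ℂ))
    have h2 : ∑ f, (F f).toReal * (h (f (x, r)) * if f (x', r') = y' then 1 else 0) =
        ∑ y, ∑ y'', prob F (fun f => f (x, r) = y ∧ f (x', r') = y'') *
          (h y * if y'' = y' then 1 else 0) := by
      exact_mod_cast this
    rw [h2]
    simp only [mul_ite, mul_one, mul_zero, Finset.sum_ite_eq', Finset.mem_univ, if_true]
  calc _ ≤ ∑ f, (F f).toReal * (h (f (x, r)) * if f (x', r') = y' then 1 else 0) := by
        refine Finset.sum_le_sum fun f _ => mul_le_mul_of_nonneg_left ?_ ENNReal.toReal_nonneg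
        by_cases hf : Wins f o
        · simp [hf, hwins f hf]
        · rw [if_neg hf, zero_mul]
          exact mul_nonneg (h0 _) (by split_ifs <;> norm_num)
    _ ≤ _ := by
        rw [hjoint, Finset.mul_sum]
        refine Finset.sum_le_sum fun y _ => ?_
        rw [hF x x' r r' y y' hne]
        have := mul_le_mul_of_nonneg_left (hν x' r' y') (mul_nonneg (prob_nonneg F
          (fun f => f (x, r) = y)) (h0 y))
        linarith

open scoped Classical in
theorem sum_wins_mul_mass_le (F : PMF (X × R → Y)) (hF : PairwiseIndependent F) {ν : ℝ}
    (hν : ∀ x r y, prob F (fun f => f (x, r) = y) ≤ ν) (o : (X × R × Y) × (X × R × Y))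
    {I : Type*} (ψ : Amplitudes X (R × Y) I) (i : I) :
    ∑ f, (F f).toReal * ((if Wins f o then 1 else 0) *
        mass (uniformWeight X R) (specialize f ψ) i) ≤ ν * mass (pairWeight F) ψ i := by
  -- The empty-database branch depends on no value of `f`, so any input pair may play the role of
  -- the recorded one.
  have h1 := sum_wins_mul_le F hF hν o o.1.1 o.1.2.1 (fun _ => ‖ψ.1 i‖ ^ 2) fun _ => sq_nonneg _
  rw [← Finset.sum_mul, sum_prob_eval_eq_one, one_mul] at h1
  have h2 : ∀ x r, ∑ f, (F f).toReal * ((if Wins f o then 1 else 0) *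
      (uniformWeight X R x r * ‖ψ.2 x (r, f (x, r)) i‖ ^ 2)) ≤
        ν * ∑ y, pairWeight F x (r, y) * ‖ψ.2 x (r, y) i‖ ^ 2 := by
    intro x r
    refine (sum_wins_mul_le F hF hν o x r
      (fun y => uniformWeight X R x r * ‖ψ.2 x (r, y) i‖ ^ 2)
      fun y => mul_nonneg (uniformWeight_nonneg x r) (sq_nonneg _)).trans_eq ?_
    congr 1
    refine Finset.sum_congr rfl fun y _ => ?_
    simp only [pairWeight, uniformWeight]
    ring
  have h3 := Finset.sum_le_sum fun x (_ : x ∈ Finset.univ) =>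
    Finset.sum_le_sum fun r (_ : r ∈ Finset.univ) => h2 x r
  calc _ = ∑ f, (F f).toReal * ((if Wins f o then 1 else 0) * ‖ψ.1 i‖ ^ 2) +
        ∑ x, ∑ r, ∑ f, (F f).toReal * ((if Wins f o then 1 else 0) *
          (uniformWeight X R x r * ‖ψ.2 x (r, f (x, r)) i‖ ^ 2)) := by
        simp only [mass, specialize, mul_add, Finset.sum_add_distrib, Finset.mul_sum]
        congr 1
        rw [Finset.sum_comm]
        exact Finset.sum_congr rfl fun x _ => Finset.sum_comm
    _ ≤ _ := add_le_add h1 h3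
    _ = _ := by
        simp only [mass, mul_add, Finset.mul_sum, Fintype.sum_prod_type]

variable [DecidableEq Y] [AddCommGroup R] [AddCommGroup Y]

theorem Adversary.winProb_le (A : Adversary X R Y) (F : PMF (X × R → Y))
    (hF : PairwiseIndependent F) {ν : ℝ}
    (hν : ∀ x r y, prob F (fun f => f (x, r) = y) ≤ ν) :
    A.winProb F ≤ 2 * ν +
      28 * (A.numQueries * (A.numQueries + 1)) * (1 / (Fintype.card R : ℝ)) := by
  classical
  -- The initial state has norm one, so the registers supply a point at which `ν` bounds a
  -- probability.
  have hν0 : 0 ≤ ν := by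
    obtain ⟨z, x, u, b⟩ : Nonempty (Registers A.workDim X Y) := by
      by_contra hempty
      rw [not_nonempty_iff] at hempty
      simpa using A.init_norm
    exact (prob_nonneg F _).trans (hν x 0 u)
  set φ := A.pairRun F A.numQueries
  have hpoint : ∀ f, A.winProbFor f ≤
      2 * ∑ i, (if Wins f (A.output i) then 1 else 0) *
          mass (uniformWeight X R) (specialize f φ) i +
        2 * normSq (uniformWeight X R) (A.functionRun f A.numQueries - specialize f φ) := by
    intro f
    rw [A.winProbFor_eq, normSq, Finset.mul_sum, Finset.mul_sum, ← Finset.sum_add_distrib]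
    refine Finset.sum_le_sum fun i _ => ?_
    -- The real run is the specialized idealized run plus the error; `s = 1` gives both factors `2`
    -- in the bound.
    have h := mass_add_le (uniformWeight_nonneg (X := X) (R := R)) one_pos (specialize f φ)
      (A.functionRun f A.numQueries - specialize f φ) i
    rw [add_sub_cancel] at h
    have h0 := mass_nonneg (uniformWeight_nonneg (X := X) (R := R))
      (A.functionRun f A.numQueries - specialize f φ) i
    split_ifs
    · linarith
    · linarith
  have hideal : ∑ f, (F f).toReal * ∑ i, (if Wins f (A.output i) then 1 else 0) *
      mass (uniformWeight X R) (specialize f φ) i ≤ ν := by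
    simp only [Finset.mul_sum]
    rw [Finset.sum_comm]
    calc _ ≤ ∑ i, ν * mass (pairWeight F) φ i :=
          Finset.sum_le_sum fun i _ => sum_wins_mul_mass_le F hF hν _ φ i
      _ = ν * normSq (pairWeight F) φ := by rw [← Finset.mul_sum, normSq]
      _ ≤ ν := mul_le_of_le_one_right hν0 (A.normSq_run_le (sum_pairWeight F) _ _)
  have herr := A.sum_normSq_functionRun_sub_le F hF A.numQueries
  calc A.winProb F ≤ ∑ f, (F f).toReal *
        (2 * ∑ i, (if Wins f (A.output i) then 1 else 0) *
          mass (uniformWeight X R) (specialize f φ) i +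
        2 * normSq (uniformWeight X R) (A.functionRun f A.numQueries - specialize f φ)) :=
        Finset.sum_le_sum fun f _ => mul_le_mul_of_nonneg_left (hpoint f) ENNReal.toReal_nonneg
    _ = 2 * ∑ f, (F f).toReal * ∑ i, (if Wins f (A.output i) then 1 else 0) *
          mass (uniformWeight X R) (specialize f φ) i +
        2 * ∑ f, (F f).toReal *
          normSq (uniformWeight X R) (A.functionRun f A.numQueries - specialize f φ) := by
        rw [Finset.mul_sum, Finset.mul_sum, ← Finset.sum_add_distrib]
        exact Finset.sum_congr rfl fun f _ => by ring
    _ ≤ 2 * ν + 2 * (A.numQueries * (A.numQueries + 1) * (14 / (Fintype.card R : ℝ))) := by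
        gcongr
    _ = _ := by ring

theorem Adversary.winProb_nonneg (A : Adversary X R Y) (F : PMF (X × R → Y)) :
    0 ≤ A.winProb F := by
  refine Finset.sum_nonneg fun f _ => mul_nonneg ENNReal.toReal_nonneg
    (Finset.sum_nonneg fun p _ => ?_)
  split_ifs
  · positivity
  · exact le_rfl

end Winning

end

end SEQ

/-! ### Asymptotics in the security parameter -/

theorem mainTheorem6 {X R Y : ℕ → Type*}
    [∀ n, Fintype (X n)] [∀ n, DecidableEq (X n)]
    [∀ n, Fintype (R n)] [∀ n, DecidableEq (R n)] [∀ n, AddCommGroup (R n)]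
    [∀ n, Fintype (Y n)] [∀ n, DecidableEq (Y n)] [∀ n, AddCommGroup (Y n)]
    (F : ∀ n, PMF (X n × R n → Y n))
    (pairwise_independent : ∀ n (x x' : X n) (r r' : R n) (y y' : Y n), (x, r) ≠ (x', r') →
      SEQ.prob (F n) (fun f => f (x, r) = y ∧ f (x', r') = y') =
        SEQ.prob (F n) (fun f => f (x, r) = y) * SEQ.prob (F n) (fun f => f (x', r') = y'))
    (highly_random : ∃ ν : ℕ → ℝ, SEQ.Negligible ν ∧
      ∀ n (x : X n) (r : R n) (y : Y n), SEQ.prob (F n) (fun f => f (x, r) = y) ≤ ν n)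
    (randomness_large : SEQ.Negligible fun n => 1 / (Fintype.card (R n) : ℝ)) :
    SEQ.NeglUnlearnable F := by
  obtain ⟨ν, hν, hbound⟩ := highly_random
  rintro A ⟨p, hp⟩
  -- The query bound is taken as a real polynomial because superpolynomial decay absorbs polynomial
  -- factors.
  let q : Polynomial ℝ := p.map (Nat.castRingHom ℝ)
  have hq : ∀ n : ℕ, q.eval (n : ℝ) = (p.eval n : ℕ) := fun n => by
    simp [q, Polynomial.eval_natCast_map]
  have hdecay : SEQ.Negligible
      ((fun n => 2 * ν n) + fun n : ℕ =>
        (Polynomial.C 28 * (q * (q + 1))).eval (n : ℝ) * (1 / (Fintype.card (R n) : ℝ))) :=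
    (hν.const_mul 2).add (randomness_large.polynomial_mul _)
  refine hdecay.trans_abs_le fun n => ?_
  simp only [Pi.add_apply]
  rw [abs_of_nonneg ((A n).winProb_nonneg (F n))]
  refine le_trans ?_ (le_abs_self _)
  refine ((A n).winProb_le (F n) (pairwise_independent n) (hbound n)).trans ?_
  have hle : ((A n).numQueries : ℝ) ≤ q.eval (n : ℝ) := by
    rw [hq]
    exact_mod_cast hp n
  have hq0 : 0 ≤ q.eval (n : ℝ) := (Nat.cast_nonneg _).trans hle
  simp only [Polynomial.eval_mul, Polynomial.eval_C, Polynomial.eval_add, Polynomial.eval_one]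
  gcongr
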